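/- Let $(R,\mathfrak m)$ be an equicharacteristic Noetherian Cohen–Macaulay local ring of dimension $d$ with infinite residue field $k=R/\mathfrak m$, and let $I$ be an $\mathfrak m$-primary ideal of $R$. Write $\lambda$ for length. If $I$ is stretched, then $I$ is $j$-stretched. Here a *reduction* of $I$ is an ideal $J\subseteq I$ with $I^{r+1}=JI^r$ for some $r\ge 0$, and a *minimal reduction* is a reduction that is minimal with respect to inclusion; the *analytic spread* $\ell(I)$ is the minimal number of generators of any minimal reduction of $I$. The $\mathfrak m$-primary ideal $I$ is *stretched* if there is a minimal reduction $H$ of $I$ such that $H\cap I^2=HI$ and $\lambda\big((I/H)^2/(I/H)^3\big)\le 1$, where $I/H$ is viewed as an ideal of $R/H$. An ideal $I$ is *$j$-stretched* if $\ell(I)=d$ and, for $d$ general elements $x_1,\dots,x_d$ of $I$, $$\lambda\big(\overline I^{\,2}/(x_d\overline I+\overline I^{\,3})\big)\le 1,$$ where $\overline R=R/\big((x_1,\dots,x_{d-1}):I^\infty\big)$, $\overline I=I\overline R$, and $J:I^\infty=\{b\in R : bI^\delta\subseteq J \text{ for some } \delta>0\}$ (if $d=0$, read $(x_1,\dots,x_{d-1})$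 and $(x_d)$ as the zero ideal). "For $d$ general elements of $I$" means: for every finite generating family $a_1,\dots,a_s$ of $I$ there is a Zariski dense open subset $U\subseteq k^{ds}$ such that the property holds for $x_i=\sum_{j}c_{ij}a_j$ $(1\le i\le d)$ whenever $c_{ij}\in R$ and the images of the $c_{ij}$ in $k$ form a point of $U$. -/

import Mathlib

open IsLocalRing

noncomputable section

namespace JStretched

variable {R : Type*} [CommRing R]

/-- A (Noetherian) local ring is Cohen-Macaulay if it admits a regular sequence whose length is the
Krull dimension, i.e. its depth equals its dimension. -/
def IsCohenMacaulayLocalRing (R : Type*) [CommRing R] [IsLocalRing R] : Prop :=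
  IsNoetherianRing R ∧
    ∃ rs : List R, RingTheory.Sequence.IsRegular R rs ∧
      ((rs.length : ℕ) : WithBot ℕ∞) = ringKrullDim R

/-- A local ring is equicharacteristic if it has the same characteristic as its residue field. -/
def IsEquicharacteristic (R : Type*) [CommRing R] [IsLocalRing R] : Prop :=
  ringChar R = ringChar (ResidueField R)

/-- The length `λ(A / B)` of the quotient of an ideal `A` by an ideal `B ≤ A`. -/
def quotLength (A B : Ideal R) : ℕ∞ :=
  Module.length R (A ⧸ B.submoduleOf A)

/-- `J` is a reduction of `I`: `J ⊆ I` and `I ^ (r + 1) = J I ^ r` for some `r ≥ 0`. -/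
def IsReduction (J I : Ideal R) : Prop :=
  J ≤ I ∧ ∃ r : ℕ, I ^ (r + 1) = J * I ^ r

/-- `J` is a minimal reduction of `I`: a reduction that is minimal with respect to inclusion. -/
def IsMinimalReduction (J I : Ideal R) : Prop :=
  Minimal (fun L : Ideal R => IsReduction L I) J

/-- The analytic spread `ℓ(I)`: the minimal number of generators of a minimal reduction of `I`.
(Over a Noetherian local ring with infinite residue field, minimal reductions exist and all have
the same minimal number of generators.) -/
def analyticSpread (I : Ideal R) : ℕ :=
  sInf {n : ℕ | ∃ J : Ideal R, IsMinimalReduction J I ∧ J.spanFinrank = n}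

/-- The saturation `J : I^∞`, the ideal of all `b` with `b I ^ δ ⊆ J` for some `δ > 0`. -/
def saturation (J I : Ideal R) : Ideal R where
  carrier := {b | ∃ δ : ℕ, 0 < δ ∧ ∀ c ∈ I ^ δ, b * c ∈ J}
  zero_mem' := ⟨1, one_pos, fun c _ => by simp⟩
  add_mem' := by
    rintro a b ⟨m, hm, ha⟩ ⟨n, hn, hb⟩
    refine ⟨max m n, lt_max_of_lt_left hm, fun c hc => ?_⟩
    rw [add_mul]
    exact J.add_mem (ha c (Ideal.pow_le_pow_right (le_max_left m n) hc))
      (hb c (Ideal.pow_le_pow_right (le_max_right m n) hc))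
  smul_mem' := by
    rintro r b ⟨m, hm, hb⟩
    refine ⟨m, hm, fun c hc => ?_⟩
    rw [smul_eq_mul, mul_assoc]
    exact J.mul_mem_left r (hb c hc)

/-- The Hilbert function `HF_I(n) = λ(I ^ n / I ^ (n + 1))`. -/
def hilbertFunction (I : Ideal R) (n : ℕ) : ℕ∞ :=
  quotLength (I ^ n) (I ^ (n + 1))

/-- An ideal `I` (taken primary to the maximal ideal) is stretched if it has a minimal reduction `H`
with `H ∩ I ^ 2 = H I` and `HF_{I/H}(2) ≤ 1`, where `I/H` is the image of `I` in `R/H`. -/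
def IsStretched (I : Ideal R) : Prop :=
  ∃ H : Ideal R, IsMinimalReduction H I ∧ H ⊓ I ^ 2 = H * I ∧
    hilbertFunction (I.map (Ideal.Quotient.mk H)) 2 ≤ 1

/-- A subset of affine space `k ^ σ` is Zariski open if it is the complement of the common zero set
of a family of polynomials. -/
def IsZariskiOpen {k σ : Type*} [Field k] (U : Set (σ → k)) : Prop :=
  ∃ S : Set (MvPolynomial σ k), U = {v | ∃ f ∈ S, MvPolynomial.eval v f ≠ 0}

/-- A Zariski open subset that is dense: it meets every nonempty Zariski open subset. -/
def IsZariskiDenseOpen {k σ : Type*} [Field k] (U : Set (σ → k)) : Prop :=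
  IsZariskiOpen U ∧ ∀ V : Set (σ → k), IsZariskiOpen V → V.Nonempty → (U ∩ V).Nonempty

/-- The property `P` holds for `t` general elements `x 0, …, x (t - 1)` of `I`: for every finite
generating family `a` of `I` there is a dense Zariski open subset `U` of `k ^ (t s)` such that `P`
holds for `x i = ∑ j, c (i, j) * a j` as soon as the residue classes of the coefficients `c` form a
point of `U`. -/
def ForGeneralElements [IsLocalRing R] (I : Ideal R) (t : ℕ) (P : (Fin t → R) → Prop) : Prop :=
  ∀ (s : ℕ) (a : Fin s → R), Ideal.span (Set.range a) = I →
    ∃ U : Set (Fin t × Fin s → ResidueField R), IsZariskiDenseOpen U ∧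
      ∀ c : Fin t × Fin s → R, (fun p => residue R (c p)) ∈ U →
        P (fun i => ∑ j, c (i, j) * a j)

/-- The ideal `J_{d-1} = (x_1, …, x_{d-1})` generated by all but the last of `d` elements. -/
def initIdeal {d : ℕ} (x : Fin d → R) : Ideal R :=
  Ideal.span (x '' {i | (i : ℕ) + 1 < d})

/-- The ideal `(x_d)` generated by the last of `d` elements (the zero ideal if `d = 0`). -/
def lastIdeal {d : ℕ} (x : Fin d → R) : Ideal R :=
  Ideal.span (x '' {i | (i : ℕ) + 1 = d})

/-- With `K = J_{d-1} : I^∞`, `R' = R / K` and `I' = I R'`, the length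
`λ(I' ^ 2 / (x_d I' + I' ^ 3))`. -/
def stretchLength (I : Ideal R) {d : ℕ} (x : Fin d → R) : ℕ∞ :=
  let q := Ideal.Quotient.mk (saturation (initIdeal x) I)
  quotLength ((I.map q) ^ 2) ((lastIdeal x).map q * I.map q ⊔ (I.map q) ^ 3)

/-- `I` is `j`-stretched: it has maximal analytic spread `ℓ(I) = d = dim R`, and
`λ(I' ^ 2 / (x_d I' + I' ^ 3)) ≤ 1` for `d` general elements `x_1, …, x_d` of `I`. -/
def IsJStretched [IsLocalRing R] (I : Ideal R) : Prop :=
  ∃ d : ℕ, ringKrullDim R = d ∧ analyticSpread I = d ∧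
    ForGeneralElements I d (fun x => stretchLength I x ≤ 1)

end JStretched

end

/-!
Write `λ` for length and `𝔪` for the maximal ideal of `R`, and let `d = dim R`.

*From stretched to a length condition.* If `H` is the minimal reduction in the definition of a
stretched ideal, then `H ⊓ I ^ 2 = H I` identifies the second graded piece of `I / H` with
`I ^ 2 / (H I + I ^ 3)`, which therefore has length at most one
(`isCyclicMod_of_hilbertFunction_le_one`). In the other direction, for `J = (x_1, …, x_d)` the module
in the definition of `j`-stretched is a quotient of `I ^ 2 / (J I + I ^ 3)`, since
`(x_1, …, x_{d-1})` lies in its saturation (`stretchLength_le_one`).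

*Spreading out.* It remains to pass from `H` to `d` general elements of `I`. The generators
`x_i a_k` of `J I` are linear in the coefficients `c` of the `x_i`, so this is an instance of
`exists_polynomial_isCyclicMod`: for a family of submodules `W(c) ≤ N` generated by elements linear
in `c`, the condition `λ(N / W(c)) ≤ 1` holds on the preimage of a Zariski open set of residue
classes as soon as it holds at one point. The point of the proof is that residue classes alone
control all lifts `c`. By Cramer's rule, if `e` generates `N / W(h)`, then it generates `N / W(c)`
for general `c`, and the relations `μ e = 0` for generators `μ` of `𝔪` deform into relations with
polynomial coefficients. Either one of these is a unit for general `c`, and then `e` vanishes in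
`N / W(c)`, or all of them lie in `𝔪`, and then they form an invertible linear system in the `μ e`.

*Minimal reductions have `d` generators.* The reduction `H` has to be generated by exactly `d`
elements, which also yields `ℓ(I) = d` (`IsMinimalReduction.spanFinrank_eq`, `analyticSpread_eq`).
Krull's height theorem gives at least `d` generators. Conversely, let `H` have `n` generators `x`.
If all monomials in `x` of the same degree were independent modulo `𝔪`, then `λ(R / H ^ r)` would
grow at least like `r ^ n`; comparison with a system of parameters inside `H` bounds it by a
multiple of `r ^ d`. So for `n > d` some form with a unit coefficient takes a value in `𝔪 H ^ e` at
`x` (`exists_form_mem_mul_pow`). As the residue field is infinite, a linear change of variables and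
Nakayama's lemma then produce a reduction of `H` with `n - 1` generators
(`exists_reduction_of_form`), contradicting minimality.
-/

namespace JStretched

/-! ### Lengths of quotients by powers of generators -/

section
variable {R : Type*} [CommRing R]

/-- Multiplication by `a` maps `R / (b, Z)` onto the kernel of `R / (a b, Z) → R / (a, Z)`. -/
lemma length_quotient_span_mul_le (Z : Ideal R) (a b : R) :
    Module.length R (R ⧸ (Ideal.span {a * b} ⊔ Z)) ≤
      Module.length R (R ⧸ (Ideal.span {a} ⊔ Z)) + Module.length R (R ⧸ (Ideal.span {b} ⊔ Z)) := by
  set A := Ideal.span {a} ⊔ Z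
  set B := Ideal.span {b} ⊔ Z
  set C := Ideal.span {a * b} ⊔ Z
  have hCA : C ≤ A := sup_le_sup_right
    (Ideal.span_singleton_le_span_singleton.mpr (dvd_mul_right a b)) _
  have hBC : B ≤ Submodule.comap (LinearMap.mulLeft R a) C := by
    refine sup_le ?_ fun z hz => ?_
    · rw [Ideal.span_le, Set.singleton_subset_iff]
      exact Ideal.mem_sup_left (Ideal.mem_span_singleton_self _)
    · exact Ideal.mem_sup_right (Z.mul_mem_left a hz)
  let f : (R ⧸ B) →ₗ[R] (R ⧸ C) := Submodule.mapQ B C (LinearMap.mulLeft R a) hBC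
  let g : (R ⧸ C) →ₗ[R] (R ⧸ A) := Submodule.factor hCA
  have hg : Function.Surjective g := Submodule.factor_surjective hCA
  have hker : LinearMap.ker g ≤ LinearMap.range f := by
    intro y hy
    obtain ⟨y, rfl⟩ := Submodule.Quotient.mk_surjective _ y
    have hy : y ∈ A := (Submodule.Quotient.mk_eq_zero A).mp hy
    obtain ⟨u, hu, z, hz, rfl⟩ := Submodule.mem_sup.mp hy
    obtain ⟨t, rfl⟩ := Ideal.mem_span_singleton'.mp hu
    refine ⟨Submodule.Quotient.mk t, ?_⟩
    simp only [f, Submodule.mapQ_apply, LinearMap.mulLeft_apply]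
    rw [Submodule.Quotient.eq]
    refine Ideal.mem_sup_right ?_
    have : a * t - (t * a + z) = -z := by ring
    rw [this]
    exact Z.neg_mem hz
  have h := Module.length_eq_add_of_exact (LinearMap.ker g).subtype g
    (Submodule.injective_subtype _) hg (LinearMap.exact_subtype_ker_map g)
  rw [h, add_comm]
  gcongr
  calc Module.length R (LinearMap.ker g) ≤ Module.length R (LinearMap.range f) :=
        Module.length_le_of_injective (Submodule.inclusion hker) (Submodule.inclusion_injective hker)
    _ ≤ _ := Module.length_le_of_surjective f.rangeRestrict f.surjective_rangeRestrict

lemma length_quotient_span_pow_le (Z : Ideal R) (a : R) (r : ℕ) :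
    Module.length R (R ⧸ (Ideal.span {a ^ r} ⊔ Z)) ≤
      r * Module.length R (R ⧸ (Ideal.span {a} ⊔ Z)) := by
  induction r with
  | zero =>
    have : Subsingleton (R ⧸ (Ideal.span {a ^ 0} ⊔ Z)) := by
      rw [Submodule.Quotient.subsingleton_iff]; simp [Ideal.span_singleton_one]
    simp [Module.length_eq_zero]
  | succ r ih =>
    rw [pow_succ]
    refine (length_quotient_span_mul_le Z _ _).trans ?_
    push_cast
    rw [add_mul, one_mul]
    gcongr

lemma length_quotient_span_image_pow_le {ι : Type*} (s : Finset ι) (y : ι → R) (Z : Ideal R)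
    (r : ℕ) :
    Module.length R (R ⧸ (Ideal.span ((fun i => y i ^ r) '' s) ⊔ Z)) ≤
      r ^ s.card * Module.length R (R ⧸ (Ideal.span (y '' s) ⊔ Z)) := by
  classical
  induction s using Finset.induction_on generalizing Z with
  | empty =>
    have e (w : ι → R) : Ideal.span (w '' ↑(∅ : Finset ι)) ⊔ Z = Z := by simp
    rw [e, e]
    simp
  | insert i s hi ih =>
    have e (w : ι → R) : Ideal.span (w '' ↑(insert i s)) ⊔ Z =
        Ideal.span (w '' s) ⊔ (Ideal.span {w i} ⊔ Z) := by
      rw [Finset.coe_insert, Set.image_insert_eq, Ideal.span_insert, sup_comm (Ideal.span {w i}),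
        sup_assoc]
    rw [e, e, Finset.card_insert_of_notMem hi]
    refine (ih _).trans ?_
    have key := length_quotient_span_pow_le (Ideal.span (y '' s) ⊔ Z) (y i) r
    rw [sup_left_comm, sup_left_comm (Ideal.span {y i})] at key
    rw [pow_succ, mul_assoc]
    exact mul_le_mul' le_rfl key

lemma multiset_prod_map_mem_pow {ι : Type*} {H : Ideal R} (x : ι → R) (hx : ∀ i, x i ∈ H)
    (t : Multiset ι) : (t.map x).prod ∈ H ^ t.card := by
  induction t using Multiset.induction_on with
  | empty => simp
  | cons i t ih =>
    rw [Multiset.map_cons, Multiset.prod_cons, Multiset.card_cons, pow_succ']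
    exact Ideal.mul_mem_mul (hx i) ih

/-! ### Analytically dependent generators -/

/-- If every `v i * x j - v j * x i` lies in `L`, then modulo `L H ^ (e - 1)` a monomial of degree
`e` in the `x j`, multiplied by `v i ^ e`, is its value at `v` times `x i ^ e`. For `e = 0` the
difference is zero, so the truncated exponent does no harm. -/
lemma multiset_prod_sub_mem {n : ℕ} {H L : Ideal R} (x v : Fin n → R)
    (hx : ∀ i, x i ∈ H) (i : Fin n) (hL : ∀ j, v i * x j - v j * x i ∈ L) (t : Multiset (Fin n)) :
    v i ^ t.card * (t.map x).prod - (t.map v).prod * x i ^ t.card ∈ L * H ^ (t.card - 1) := by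
  induction t using Multiset.induction_on with
  | empty => simp
  | cons j t ih =>
    rw [Multiset.map_cons, Multiset.prod_cons, Multiset.card_cons, Multiset.map_cons,
      Multiset.prod_cons, Nat.add_sub_cancel]
    have e : v i ^ (t.card + 1) * (x j * (t.map x).prod) -
        v j * (t.map v).prod * x i ^ (t.card + 1) =
        (v i * x j - v j * x i) * (v i ^ t.card * (t.map x).prod) +
        v j * (x i * (v i ^ t.card * (t.map x).prod - (t.map v).prod * x i ^ t.card)) := by ring
    rw [e]
    refine Ideal.add_mem _ (Ideal.mul_mem_mul (hL j)
      (Ideal.mul_mem_left _ _ (multiset_prod_map_mem_pow x hx t))) (Ideal.mul_mem_left _ _ ?_)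
    rcases Multiset.empty_or_exists_mem t with rfl | ⟨k, hk⟩
    · simp
    · have hc : t.card = t.card - 1 + 1 := by
        have := Multiset.card_pos_iff_exists_mem.mpr ⟨k, hk⟩
        omega
      rw [hc, pow_succ', ← mul_assoc, mul_comm L, mul_assoc, ← hc]
      exact Ideal.mul_mem_mul (hx i) ih

variable [IsLocalRing R]

lemma length_residueField : Module.length R (ResidueField R) = 1 := by
  have : IsSimpleModule R (ResidueField R) :=
    isSimpleModule_iff_quot_maximal.mpr ⟨maximalIdeal R, inferInstance, ⟨LinearEquiv.refl _ _⟩⟩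
  exact Module.length_eq_one R _

/-- If no form of degree `e` with a unit coefficient has value in `𝔪 H ^ e` at the generators `x`
of `H`, then the monomials of degree `e` are independent in `H ^ e / 𝔪 H ^ e`. -/
lemma length_quotient_pow_add_card_le {n : ℕ} (x : Fin n → R) {H : Ideal R}
    (hx : ∀ i, x i ∈ H) (hH : H ≤ maximalIdeal R) (e : ℕ)
    (hind : ∀ G : Sym (Fin n) e → R, ∑ s, G s * (s.1.map x).prod ∈ maximalIdeal R * H ^ e →
      ∀ s, G s ∈ maximalIdeal R) :
    (Fintype.card (Sym (Fin n) e) : ℕ∞) + Module.length R (R ⧸ H ^ e) ≤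
      Module.length R (R ⧸ H ^ (e + 1)) := by
  set Q := maximalIdeal R * H ^ e
  have h1 : H ^ (e + 1) ≤ Q := by
    rw [pow_succ']; exact Ideal.mul_mono_left hH
  have h2 : Q ≤ H ^ e := Ideal.mul_le_right
  refine le_trans ?_ (Module.length_le_of_surjective (Submodule.factor h1)
    (Submodule.factor_surjective h1))
  let g : (R ⧸ Q) →ₗ[R] (R ⧸ H ^ e) := Submodule.factor h2
  rw [Module.length_eq_add_of_exact (LinearMap.ker g).subtype g
    (Submodule.injective_subtype _) (Submodule.factor_surjective h2)
    (LinearMap.exact_subtype_ker_map g)]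
  gcongr
  have hmem (s : Sym (Fin n) e) : (s.1.map x).prod ∈ H ^ e := by
    simpa using multiset_prod_map_mem_pow x hx s.1
  let f : (Sym (Fin n) e → R) →ₗ[R] (R ⧸ Q) :=
    Q.mkQ.comp (Fintype.linearCombination R fun s : Sym (Fin n) e => (s.1.map x).prod)
  let p : (Sym (Fin n) e → R) →ₗ[R] (Sym (Fin n) e → ResidueField R) :=
    (Algebra.linearMap R (ResidueField R)).compLeft _
  have hp : Function.Surjective p := fun v => by
    choose w hw using fun s => residue_surjective (v s)
    exact ⟨w, funext hw⟩
  have hker : LinearMap.ker f ≤ LinearMap.ker p := by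
    intro G hG
    have hG : ∑ s, G s * (s.1.map x).prod ∈ Q := by
      have h := (Submodule.Quotient.mk_eq_zero Q).mp (LinearMap.mem_ker.mp hG)
      simpa [Fintype.linearCombination_apply] using h
    ext s
    exact (residue_eq_zero_iff _).mpr (hind G hG s)
  have hrange : LinearMap.range f ≤ LinearMap.ker g := by
    rintro _ ⟨G, rfl⟩
    simp only [f, g, LinearMap.mem_ker, LinearMap.comp_apply, Submodule.mkQ_apply,
      Fintype.linearCombination_apply]
    erw [Submodule.factor_mk]
    exact (Submodule.Quotient.mk_eq_zero _).mpr
      (Ideal.sum_mem _ fun s _ => Ideal.mul_mem_left _ _ (hmem s))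
  calc (Fintype.card (Sym (Fin n) e) : ℕ∞)
      = Module.length R (Sym (Fin n) e → ResidueField R) := by
        simp [Module.length_pi_of_fintype, length_residueField]
    _ ≤ Module.length R ((Sym (Fin n) e → R) ⧸ LinearMap.ker f) := by
        rw [← (p.quotKerEquivOfSurjective hp).length_eq]
        exact Module.length_le_of_surjective (Submodule.factor hker)
          (Submodule.factor_surjective hker)
    _ = Module.length R (LinearMap.range f) := f.quotKerEquivRange.length_eq
    _ ≤ _ := Module.length_le_of_injective (Submodule.inclusion hrange)
        (Submodule.inclusion_injective hrange)

lemma sum_range_card_sym (n r : ℕ) :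
    ∑ e ∈ Finset.range (r + 1), Fintype.card (Sym (Fin n) e) = Nat.multichoose (n + 1) r := by
  induction r with
  | zero => simp
  | succ r ih =>
    rw [Finset.sum_range_succ, ih, Sym.card_sym_eq_multichoose, Fintype.card_fin,
      Nat.multichoose_succ_succ, add_comm]

lemma pow_le_factorial_mul_sum_card_sym (n r : ℕ) :
    (r + 1) ^ n ≤ n.factorial * ∑ e ∈ Finset.range (r + 1), Fintype.card (Sym (Fin n) e) := by
  rw [sum_range_card_sym, Nat.multichoose_eq, show n + 1 + r - 1 = r + n by omega,
    Nat.choose_symm_add, ← Nat.ascFactorial_eq_factorial_mul_choose]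
  exact Nat.pow_succ_le_ascFactorial _ _

lemma height_eq_of_radical_eq [IsNoetherianRing R] {H : Ideal R}
    (hrad : H.radical = maximalIdeal R) : H.height = (maximalIdeal R).height := by
  rw [← hrad, Ideal.height_eq_inf_minimalPrimes, Ideal.height_eq_inf_minimalPrimes,
    Ideal.radical_minimalPrimes]

/-- A counting argument: if `H` is `𝔪`-primary and has more than `dim R` generators `x`, then
`λ(R / H ^ r)` is bounded by a multiple of `r ^ dim R`, so the monomials in `x` cannot be
independent in `H ^ e / 𝔪 H ^ e` for all `e`. -/
lemma exists_form_mem_mul_pow [IsNoetherianRing R] {H : Ideal R}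
    (hrad : H.radical = maximalIdeal R) {d : ℕ} (hd : ringKrullDim R = d) {n : ℕ} (hn : d < n)
    (x : Fin n → R) (hx : ∀ i, x i ∈ H) :
    ∃ (e : ℕ) (G : Sym (Fin n) e → R),
      ∑ s, G s * (s.1.map x).prod ∈ maximalIdeal R * H ^ e ∧ ∃ s, G s ∉ maximalIdeal R := by
  by_contra! hcon
  have hHm : H ≤ maximalIdeal R := hrad ▸ Ideal.le_radical
  have hm : (maximalIdeal R).height = d := by
    have := maximalIdeal_height_eq_ringKrullDim (R := R)
    rw [hd] at this
    exact_mod_cast this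
  -- The lower bound for the length of `R / H ^ r`.
  have hlow (r : ℕ) : ((∑ e ∈ Finset.range r, Fintype.card (Sym (Fin n) e) : ℕ) : ℕ∞) ≤
      Module.length R (R ⧸ H ^ r) := by
    induction r with
    | zero => simp
    | succ r ih =>
      refine le_trans ?_ (length_quotient_pow_add_card_le x hx hHm r (hcon r))
      rw [Finset.sum_range_succ, add_comm]
      push_cast at ih ⊢
      gcongr
  -- The upper bound, from a system of parameters in `H`.
  obtain ⟨Y, hYH, hYr, hYh⟩ := H.exists_spanRank_eq_and_height_eq
    (ne_top_of_le_ne_top (Ideal.IsPrime.ne_top inferInstance) hHm)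
  rw [height_eq_of_radical_eq hrad, hm] at hYr hYh
  have hYart : IsArtinianRing (R ⧸ Y) :=
    quotient_artinian_of_mem_minimalPrimes_of_isLocalRing Y
      (Ideal.mem_minimalPrimes_of_height_le (hYH.trans hHm) (by rw [hm, hYh]))
  obtain ⟨t, htc, htY⟩ := Submodule.FG.exists_span_finset_card_eq_spanFinrank
    (IsNoetherian.noetherian Y)
  have htd : t.card = d := by
    rw [htc, Submodule.spanFinrank, hYr]; simp
  have hL : Module.length R (R ⧸ Y) ≠ ⊤ := by
    rw [Module.length_eq_of_surjective (R := R ⧸ Y) Ideal.Quotient.mk_surjective]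
    exact Module.length_ne_top
  obtain ⟨L, hL⟩ := ENat.ne_top_iff_exists.mp hL
  -- The powers `y ^ r` of the generators `y` of `Y` generate an ideal inside `H ^ r`.
  have hup (r : ℕ) : Module.length R (R ⧸ H ^ r) ≤ ((r ^ d * L : ℕ) : ℕ∞) := by
    have h := length_quotient_span_image_pow_le t id ⊥ r
    have e : Ideal.span (id '' (t : Set R)) = Y := by rw [Set.image_id]; exact htY
    rw [e, sup_bot_eq, sup_bot_eq, htd, ← hL] at h
    push_cast
    refine le_trans ?_ h
    have hle : Ideal.span ((fun i => id i ^ r) '' (t : Set R)) ≤ H ^ r := by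
      rw [Ideal.span_le]
      rintro _ ⟨i, hi, rfl⟩
      exact Ideal.pow_mem_pow (hYH (htY ▸ Submodule.subset_span hi)) r
    exact Module.length_le_of_surjective (Submodule.factor hle) (Submodule.factor_surjective hle)
  -- A polynomial of degree `n` cannot be bounded by one of degree `d < n`.
  have hcmp (r : ℕ) : r + 1 ≤ n.factorial * L := by
    have h1 := (hlow (r + 1)).trans (hup (r + 1))
    have h1 : ∑ e ∈ Finset.range (r + 1), Fintype.card (Sym (Fin n) e) ≤ (r + 1) ^ d * L := by
      exact_mod_cast h1
    have h2 := (pow_le_factorial_mul_sum_card_sym n r).trans (Nat.mul_le_mul_left _ h1)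
    have h3 : (r + 1) ^ (d + 1) ≤ (r + 1) ^ n := Nat.pow_le_pow_right (Nat.succ_pos r) hn
    have h4 : (r + 1) ^ d * (r + 1) ≤ (r + 1) ^ d * (n.factorial * L) := by
      rw [← pow_succ]
      refine (h3.trans h2).trans_eq ?_
      ring
    exact Nat.le_of_mul_le_mul_left h4 (by positivity)
  exact absurd (hcmp (n.factorial * L)) (by omega)

/-- Over an infinite residue field a form with a unit coefficient takes a unit value. -/
lemma exists_form_eval_notMem (hk : Infinite (ResidueField R)) {n e : ℕ}
    (G : Sym (Fin n) e → R) {s : Sym (Fin n) e} (hs : G s ∉ maximalIdeal R) :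
    ∃ v : Fin n → R, ∑ s, G s * (s.1.map v).prod ∉ maximalIdeal R := by
  classical
  let F : MvPolynomial (Fin n) (ResidueField R) :=
    ∑ s, MvPolynomial.monomial (Multiset.toFinsupp s.1) (residue R (G s))
  have hF : F ≠ 0 := by
    intro h
    have h := congrArg (MvPolynomial.coeff (Multiset.toFinsupp s.1)) h
    simp only [F, MvPolynomial.coeff_sum, MvPolynomial.coeff_monomial,
      EmbeddingLike.apply_eq_iff_eq, MvPolynomial.coeff_zero] at h
    rw [Finset.sum_eq_single s (fun b _ hb => if_neg fun h => hb (Subtype.ext h)) (by simp),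
      if_pos rfl] at h
    exact hs ((residue_eq_zero_iff _).mp h)
  obtain ⟨v, hv⟩ : ∃ v, MvPolynomial.eval v F ≠ 0 := by
    by_contra! h
    exact hF (MvPolynomial.funext fun v => by simpa using h v)
  choose w hw using fun i => residue_surjective (v i)
  refine ⟨w, fun h => hv ?_⟩
  rw [← residue_eq_zero_iff] at h
  rw [← h]
  simp only [F, map_sum, map_mul, map_multiset_prod, Multiset.map_map, MvPolynomial.eval_monomial]
  refine Finset.sum_congr rfl fun s _ => ?_
  congr 1
  rw [Finset.prod_multiset_map_count]
  exact Finset.prod_congr rfl fun i _ => by simp [hw]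

/-- A generating system `x` of `H` which is analytically dependent can be shortened: `H` has a
reduction with one generator less. If the form takes a unit value at `v` and `v i` is a unit, the
reduction is generated by the elements `v i * x j - v j * x i` with `j ≠ i`. -/
lemma exists_reduction_of_form [IsNoetherianRing R] (hk : Infinite (ResidueField R)) {H : Ideal R}
    {n : ℕ} (x : Fin n → R) (hx : Ideal.span (Set.range x) = H) (e : ℕ)
    (G : Sym (Fin n) e → R) (hG : ∑ s, G s * (s.1.map x).prod ∈ maximalIdeal R * H ^ e)
    {s : Sym (Fin n) e} (hs : G s ∉ maximalIdeal R) :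
    ∃ L : Ideal R, IsReduction L H ∧ L.spanFinrank < n := by
  classical
  have hxH (i) : x i ∈ H := hx ▸ Ideal.subset_span ⟨i, rfl⟩
  obtain ⟨v, hv⟩ := exists_form_eval_notMem hk G hs
  have he : e ≠ 0 := by
    rintro rfl
    have h1 (w : Fin n → R) (s : Sym (Fin n) 0) : (s.1.map w).prod = 1 := by
      rw [Multiset.card_eq_zero.mp s.2]; simp
    simp only [h1] at hG hv
    exact hv (Ideal.mul_le_left hG)
  obtain ⟨i, hi⟩ : ∃ i, v i ∉ maximalIdeal R := by
    by_contra! h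
    refine hv (Ideal.sum_mem _ fun s _ => Ideal.mul_mem_left _ _ ?_)
    have := multiset_prod_map_mem_pow v h s.1
    rw [s.2] at this
    exact Ideal.pow_le_self he this
  have hvi : IsUnit (v i) := by simpa using hi
  have hGv : IsUnit (∑ s, G s * (s.1.map v).prod) := by simpa using hv
  let L : Ideal R := Ideal.span ((fun j => v i * x j - v j * x i) '' {j | j ≠ i})
  have hL (j) : v i * x j - v j * x i ∈ L := by
    by_cases hj : j = i
    · subst hj; simp
    · exact Ideal.subset_span ⟨j, hj, rfl⟩
  have hLH : L ≤ H := by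
    rw [Ideal.span_le]
    rintro _ ⟨j, -, rfl⟩
    exact H.sub_mem (H.mul_mem_left _ (hxH j)) (H.mul_mem_left _ (hxH i))
  have hHL : H ≤ L ⊔ Ideal.span {x i} := by
    rw [← hx, Ideal.span_le]
    rintro _ ⟨j, rfl⟩
    refine (Ideal.unit_mul_mem_iff_mem _ hvi).mp ?_
    rw [← sub_add_cancel (v i * x j) (v j * x i)]
    exact Submodule.add_mem_sup (hL j) (Ideal.mem_span_singleton'.mpr ⟨v j, rfl⟩)
  obtain ⟨e, rfl⟩ : ∃ e', e = e' + 1 := ⟨e - 1, by omega⟩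
  -- Comparing `G(x)` with `G(v) x_i ^ (e + 1)` puts the latter into `L H ^ e + 𝔪 H ^ (e + 1)`.
  have hxi : x i ^ (e + 1) ∈ L * H ^ e ⊔ maximalIdeal R * H ^ (e + 1) := by
    refine (Ideal.unit_mul_mem_iff_mem _ hGv).mp ?_
    have h1 : v i ^ (e + 1) * ∑ s, G s * (s.1.map x).prod -
        (∑ s, G s * (s.1.map v).prod) * x i ^ (e + 1) ∈ L * H ^ e := by
      rw [Finset.mul_sum, Finset.sum_mul, ← Finset.sum_sub_distrib]
      refine Ideal.sum_mem _ fun s _ => ?_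
      have h := multiset_prod_sub_mem x v hxH i hL s.1
      rw [s.2, Nat.add_sub_cancel] at h
      have e1 : v i ^ (e + 1) * (G s * (s.1.map x).prod) - G s * (s.1.map v).prod * x i ^ (e + 1) =
        G s * (v i ^ (e + 1) * (s.1.map x).prod - (s.1.map v).prod * x i ^ (e + 1)) := by ring
      rw [e1]
      exact Ideal.mul_mem_left _ _ h
    rw [← sub_sub_self (v i ^ (e + 1) * ∑ s, G s * (s.1.map x).prod)
      ((∑ s, G s * (s.1.map v).prod) * x i ^ (e + 1))]
    exact Ideal.sub_mem _ (Ideal.mem_sup_right (Ideal.mul_mem_left _ _ hG)) (Ideal.mem_sup_left h1)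
  have hpow : ∀ m : ℕ, H ^ (m + 1) ≤ L * H ^ m ⊔ Ideal.span {x i ^ (m + 1)} := by
    intro m
    induction m with
    | zero => simpa using hHL
    | succ m ih =>
      rw [pow_succ' H (m + 1)]
      calc H * H ^ (m + 1) ≤ (L ⊔ Ideal.span {x i}) * H ^ (m + 1) := Ideal.mul_mono_left hHL
        _ = L * H ^ (m + 1) ⊔ Ideal.span {x i} * H ^ (m + 1) := Ideal.sup_mul _ _ _
        _ ≤ L * H ^ (m + 1) ⊔ Ideal.span {x i} * (L * H ^ m ⊔ Ideal.span {x i ^ (m + 1)}) := by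
            gcongr
        _ ≤ _ := by
            rw [Ideal.mul_sup, Ideal.span_singleton_mul_span_singleton, ← pow_succ']
            refine sup_le le_sup_left (sup_le (le_sup_of_le_left ?_) le_sup_right)
            rw [mul_left_comm, pow_succ' H m]
            exact Ideal.mul_mono_right (Ideal.mul_mono_left
              ((Ideal.span_singleton_le_iff_mem _).mpr (hxH i)))
  have hle : H ^ (e + 1) ≤ L * H ^ e := by
    refine Submodule.le_of_le_smul_of_le_jacobson_bot (I := maximalIdeal R)
      (IsNoetherian.noetherian _) (maximalIdeal_le_jacobson _) ?_
    refine (hpow e).trans (sup_le le_sup_left ?_)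
    rwa [Ideal.span_singleton_le_iff_mem]
  refine ⟨L, ⟨hLH, e, le_antisymm hle ?_⟩, ?_⟩
  · rw [pow_succ']; exact Ideal.mul_mono_left hLH
  · have hfin : ({j | j ≠ i} : Set (Fin n)).Finite := Set.toFinite _
    calc L.spanFinrank ≤ _ := Submodule.spanFinrank_span_le_ncard_of_finite (hfin.image _)
      _ ≤ ({j | j ≠ i} : Set (Fin n)).ncard := Set.ncard_image_le hfin
      _ < (Set.univ : Set (Fin n)).ncard :=
        Set.ncard_lt_ncard ⟨Set.subset_univ _, fun h => h (Set.mem_univ i) rfl⟩ Set.finite_univ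
      _ = n := by simp [Set.ncard_univ]

end

section
variable {R : Type*} [CommRing R]

/-! ### Minimal reductions of primary ideals -/

lemma IsReduction.trans {L H I : Ideal R} (h₁ : IsReduction L H) (h₂ : IsReduction H I) :
    IsReduction L I := by
  obtain ⟨hLH, r, hr⟩ := h₁
  obtain ⟨hHI, s, hs⟩ := h₂
  refine ⟨hLH.trans hHI, r + s, ?_⟩
  have key (n : ℕ) : I ^ (n + s) = H ^ n * I ^ s := by
    induction n with
    | zero => simp
    | succ n ih => rw [show n + 1 + s = n + (s + 1) by ring, pow_add, hs, pow_succ, mul_assoc,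
        mul_left_comm, ← pow_add, ih, mul_left_comm]
  rw [show r + s + 1 = r + 1 + s by ring, key, hr, mul_assoc, ← key]

lemma IsReduction.radical_eq {H I : Ideal R} (h : IsReduction H I) : H.radical = I.radical := by
  obtain ⟨hHI, r, hr⟩ := h
  refine le_antisymm (Ideal.radical_mono hHI) ?_
  rw [Ideal.radical_le_radical_iff]
  intro a ha
  refine ⟨r + 1, ?_⟩
  exact (hr.trans_le Ideal.mul_le_left : I ^ (r + 1) ≤ H) (Ideal.pow_mem_pow ha _)

lemma exists_span_range_eq_of_spanFinrank [IsNoetherianRing R] (H : Ideal R) {n : ℕ}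
    (hn : H.spanFinrank = n) : ∃ x : Fin n → R, Ideal.span (Set.range x) = H := by
  obtain ⟨t, htc, htH⟩ := Submodule.FG.exists_span_finset_card_eq_spanFinrank
    (IsNoetherian.noetherian H)
  refine ⟨Subtype.val ∘ (t.equivFinOfCardEq (htc.trans hn)).symm, ?_⟩
  rw [Set.range_comp, Equiv.range_eq_univ, Set.image_univ, Subtype.range_coe]
  exact htH

/-- A minimal reduction of an `𝔪`-primary ideal is generated by `dim R` elements, and no fewer. -/
lemma IsMinimalReduction.spanFinrank_eq [IsLocalRing R] [IsNoetherianRing R]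
    (hk : Infinite (ResidueField R)) {H I : Ideal R} (hI : I.radical = maximalIdeal R)
    (hH : IsMinimalReduction H I) {d : ℕ} (hd : ringKrullDim R = d) : H.spanFinrank = d := by
  have hrad : H.radical = maximalIdeal R := by rw [hH.prop.radical_eq, hI]
  have hHm : H ≤ maximalIdeal R := hrad ▸ Ideal.le_radical
  refine le_antisymm ?_ ?_
  · by_contra! hlt
    obtain ⟨x, hx⟩ := exists_span_range_eq_of_spanFinrank H rfl
    have hxH (i) : x i ∈ H := by
      have := Ideal.subset_span (Set.mem_range_self (f := x) i)
      rwa [hx] at this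
    obtain ⟨e, G, hG, s, hs⟩ := exists_form_mem_mul_pow hrad hd hlt x hxH
    obtain ⟨L, hL, hLn⟩ := exists_reduction_of_form hk x hx e G hG hs
    have := hH.eq_of_le (hL.trans hH.prop) hL.1
    subst this
    exact lt_irrefl _ hLn
  · have h := H.height_le_spanFinrank (ne_top_of_le_ne_top (Ideal.IsPrime.ne_top inferInstance) hHm)
    have h2 := maximalIdeal_height_eq_ringKrullDim (R := R)
    rw [height_eq_of_radical_eq hrad] at h
    rw [hd] at h2
    have h2 : (maximalIdeal R).height = d := by exact_mod_cast h2
    rw [h2] at h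
    exact_mod_cast h

lemma analyticSpread_eq [IsLocalRing R] [IsNoetherianRing R]
    (hk : Infinite (ResidueField R)) {H I : Ideal R} (hI : I.radical = maximalIdeal R)
    (hH : IsMinimalReduction H I) {d : ℕ} (hd : ringKrullDim R = d) : analyticSpread I = d := by
  have : {n : ℕ | ∃ J : Ideal R, IsMinimalReduction J I ∧ J.spanFinrank = n} = {d} := by
    ext n
    constructor
    · rintro ⟨J, hJ, rfl⟩
      exact hJ.spanFinrank_eq hk hI hd
    · rintro rfl
      exact ⟨H, hH, hH.spanFinrank_eq hk hI hd⟩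
  rw [analyticSpread, this, csInf_singleton]

end

/-! ### Generic length bounds for linear families of submodules -/

section
variable {R : Type*} [CommRing R]

/-- A square linear system `A u = b` gives `det A • u = adj A b`. -/
lemma det_smul_eq_of_sum_smul_eq {M τ : Type*} [AddCommGroup M] [Module R M] [Fintype τ]
    [DecidableEq τ] (A : Matrix τ τ R) (u b : τ → M) (h : ∀ l, ∑ l', A l l' • u l' = b l) (l : τ) :
    A.det • u l = ∑ l', A.adjugate l l' • b l' := by
  simp_rw [← h, Finset.smul_sum, smul_smul]
  rw [Finset.sum_comm]
  simp_rw [← Finset.sum_smul, ← Matrix.mul_apply, Matrix.adjugate_mul, Matrix.smul_apply,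
    Matrix.one_apply, smul_eq_mul, mul_ite, mul_one, mul_zero, ite_smul, zero_smul]
  simp

variable [IsLocalRing R]

lemma residue_eval {σ : Type*} (p : MvPolynomial σ R) (c : σ → R) :
    residue R (MvPolynomial.eval c p) =
      MvPolynomial.eval (fun i => residue R (c i)) (MvPolynomial.map (residue R) p) := by
  rw [MvPolynomial.eval_map]
  exact MvPolynomial.eval₂_comp_left (residue R) (RingHom.id R) c p

/-- The quotient `N / (N ⊓ W)` is cyclic and killed by `𝔪`, that is, of length at most one. The
generator `e` is allowed to be zero in the quotient, and `W` need not be contained in `N`. -/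
def IsCyclicMod {M : Type*} [AddCommGroup M] [Module R M] (N W : Submodule R M) : Prop :=
  ∃ e ∈ N, N ≤ W ⊔ Submodule.span R {e} ∧ ∀ μ ∈ maximalIdeal R, μ • e ∈ W

/-- Let `W(c)` be generated by a fixed submodule `B` and by elements of `N` which are linear in
`c`. If `N / W(h)` has length at most one for a single `h`, then so does `N / W(c)` for all `c` whose
residue classes lie in a nonempty Zariski open set. Different lifts `c` of the same residue classes
can give different submodules `W(c)`. -/
lemma exists_polynomial_isCyclicMod [IsNoetherianRing R] (hk : Infinite (ResidueField R))
    {M σ τ : Type*} [AddCommGroup M] [Module R M] [Finite σ] [Fintype τ]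
    (N B : Submodule R M) (g : τ → (σ → R) →ₗ[R] M) (hg : ∀ l c, g l c ∈ N) (h : σ → R)
    (hcyc : IsCyclicMod N (B ⊔ Submodule.span R (Set.range fun l => g l h))) :
    ∃ F : MvPolynomial σ (ResidueField R), F ≠ 0 ∧ ∀ c : σ → R,
      MvPolynomial.eval (fun i => residue R (c i)) F ≠ 0 →
        IsCyclicMod N (B ⊔ Submodule.span R (Set.range fun l => g l c)) := by
  classical
  have := Fintype.ofFinite σ
  obtain ⟨e, heN, hN, he⟩ := hcyc
  let w : τ → M := fun l => g l h
  -- It suffices to find a polynomial in the coordinates `c - h`.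
  suffices H : ∃ F : MvPolynomial σ R, MvPolynomial.map (residue R) F ≠ 0 ∧ ∀ c : σ → R,
      IsUnit (MvPolynomial.eval c F) →
        IsCyclicMod N (B ⊔ Submodule.span R (Set.range fun l => g l (h + c))) by
    obtain ⟨F, hF, hFc⟩ := H
    let F' : MvPolynomial σ R :=
      MvPolynomial.bind₁ (fun i => MvPolynomial.X i - MvPolynomial.C (h i)) F
    have heval (c : σ → R) : MvPolynomial.eval c F' = MvPolynomial.eval (c - h) F := by
      simp only [F', MvPolynomial.eval, MvPolynomial.eval₂Hom_bind₁]
      congr 2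
      ext i
      simp
    refine ⟨MvPolynomial.map (residue R) F', ?_, fun c hc => ?_⟩
    · intro h0
      refine hF (MvPolynomial.funext fun v => ?_)
      choose c hc using fun i => residue_surjective (v i)
      have h1 := residue_eval F c
      rw [show c = (c + h) - h by simp, ← heval, residue_eval, h0] at h1
      simpa [hc] using h1.symm
    · rw [← residue_eval, heval] at hc
      have := hFc (c - h) (by simpa using hc)
      simpa using this
  -- Write the generators at the `j`-th unit vector in terms of the generators `w` at `h` and `e`.
  have hrep (l : τ) (j : σ) : ∃ (A : τ → R) (β : R),
      g l (Pi.single j 1) - (∑ l', A l' • w l' + β • e) ∈ B := by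
    have h1 := hN (hg l (Pi.single j 1))
    obtain ⟨y, hy, z, hz, hyz⟩ := Submodule.mem_sup.mp h1
    obtain ⟨b, hb, y', hy', rfl⟩ := Submodule.mem_sup.mp hy
    obtain ⟨A, rfl⟩ := (Submodule.mem_span_range_iff_exists_fun R).mp hy'
    obtain ⟨β, rfl⟩ := Submodule.mem_span_singleton.mp hz
    refine ⟨A, β, ?_⟩
    rw [← hyz]
    convert hb using 1
    simp only [w]
    abel
  choose A β hAβ using hrep
  -- Generators of the maximal ideal, and the relations saying that they kill `e`.
  obtain ⟨p, μ, hμ⟩ := Submodule.fg_iff_exists_fin_generating_family.mp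
    (IsNoetherian.noetherian (maximalIdeal R))
  have hμm (q) : μ q ∈ maximalIdeal R := hμ ▸ Submodule.subset_span ⟨q, rfl⟩
  have hrel (q : Fin p) : ∃ r : τ → R, μ q • e - ∑ l, r l • w l ∈ B := by
    obtain ⟨b, hb, y', hy', hsum⟩ := Submodule.mem_sup.mp (he (μ q) (hμm q))
    obtain ⟨r, rfl⟩ := (Submodule.mem_span_range_iff_exists_fun R).mp hy'
    refine ⟨r, ?_⟩
    rw [← hsum]
    simpa [w] using hb
  choose r hr using hrel
  -- The generators at `h + c` are `S(c) w + b(c) e`.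
  let S : Matrix τ τ (MvPolynomial σ R) :=
    1 + Matrix.of fun l l' => ∑ j, MvPolynomial.C (A l j l') * MvPolynomial.X j
  let b : τ → MvPolynomial σ R := fun l => ∑ j, MvPolynomial.C (β l j) * MvPolynomial.X j
  -- By Cramer's rule `D(c) w = -(adj S(c) b(c)) e` in the quotient at `h + c`, so that the relation
  -- `μ q • e = ∑ r q l • w l` becomes `(D(c) * μ q + P q (c)) • e = 0`. As `S(0) = 1` and `b(0) = 0`,
  -- the constant coefficients of `D` and `P q` are `1` and `0`.
  let D := S.det
  let P : Fin p → MvPolynomial σ R := fun q =>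
    ∑ l, MvPolynomial.C (r q l) * ∑ l', S.adjugate l l' * b l'
  have hD0 : MvPolynomial.constantCoeff D = 1 := by
    have : MvPolynomial.constantCoeff.mapMatrix S = 1 := by
      ext l l'
      simp only [RingHom.mapMatrix_apply, Matrix.map_apply, S, Matrix.add_apply,
        Matrix.of_apply, map_add, map_sum, map_mul,
        MvPolynomial.constantCoeff_X, mul_zero, Finset.sum_const_zero, add_zero, Matrix.one_apply]
      split_ifs <;> simp
    rw [RingHom.map_det, this, Matrix.det_one]
  have hP0 (q) : MvPolynomial.constantCoeff (P q) = 0 := by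
    simp [P, b]
  have hDne : MvPolynomial.map (residue R) D ≠ 0 := by
    intro h0
    have := congrArg MvPolynomial.constantCoeff h0
    simp [MvPolynomial.constantCoeff_map, hD0] at this
  -- The relations in the quotient at `h + c`.
  have hquot (c : σ → R) {W : Submodule R M} (π : M →ₗ[R] M ⧸ W) (hB : ∀ y ∈ B, π y = 0)
      (hπ : ∀ l, π (g l (h + c)) = 0) :
      (∀ l, MvPolynomial.eval c D • π (w l) =
        - ((∑ l', MvPolynomial.eval c (S.adjugate l l' * b l')) • π e)) ∧
      ∀ q, (MvPolynomial.eval c D * μ q + MvPolynomial.eval c (P q)) • π e = 0 := by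
    have h1 (l : τ) : ∑ l', MvPolynomial.eval c (S l l') • π (w l') =
        - (MvPolynomial.eval c (b l) • π e) := by
      have h2 := hπ l
      have h3 : g l (h + c) = w l + ∑ j, c j • g l (Pi.single j 1) := by
        rw [map_add]
        congr 1
        conv_lhs => rw [pi_eq_sum_univ' c]
        simp only [map_sum, map_smul]
      have h4 (j : σ) : π (g l (Pi.single j 1)) =
          ∑ l', A l j l' • π (w l') + β l j • π e := by
        have := hB _ (hAβ l j)
        rw [map_sub, sub_eq_zero] at this
        simpa using this
      rw [h3, map_add, map_sum] at h2
      simp only [map_smul, h4, smul_add, Finset.sum_add_distrib, Finset.smul_sum, smul_smul] at h2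
      rw [eq_neg_iff_add_eq_zero, ← h2]
      simp only [S, b, Matrix.add_apply, Matrix.of_apply, map_add, map_sum, map_mul,
        MvPolynomial.eval_C, MvPolynomial.eval_X, add_smul, Finset.sum_add_distrib, Finset.sum_smul]
      rw [Finset.sum_comm, add_assoc]
      congr 1
      · rw [Finset.sum_eq_single l]
        · simp
        · intro l' _ hl'
          simp [Matrix.one_apply_ne hl'.symm]
        · simp
      · simp only [mul_comm]
    have h5 (l : τ) : MvPolynomial.eval c D • π (w l) =
        - ((∑ l', MvPolynomial.eval c (S.adjugate l l' * b l')) • π e) := by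
      have := det_smul_eq_of_sum_smul_eq ((MvPolynomial.eval c).mapMatrix S)
        (fun l => π (w l)) _ h1 l
      rw [← RingHom.map_det, ← RingHom.map_adjugate] at this
      rw [this, Finset.sum_smul, ← Finset.sum_neg_distrib]
      simp [smul_smul]
    refine ⟨h5, fun q => ?_⟩
    have h6 : μ q • π e = ∑ l, r q l • π (w l) := by
      have := hB _ (hr q)
      rw [map_sub, sub_eq_zero] at this
      simpa using this
    rw [add_smul, mul_smul, h6, Finset.smul_sum]
    simp_rw [smul_comm (MvPolynomial.eval c D), h5]
    simp [P, smul_smul, Finset.sum_smul, Finset.smul_sum, Finset.mul_sum]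
  have hmkQ (c : σ → R) {W : Submodule R M}
      (hW : W = B ⊔ Submodule.span R (Set.range fun l => g l (h + c))) :=
    hquot c W.mkQ
      (fun y hy => (Submodule.Quotient.mk_eq_zero W).mpr (hW ▸ Submodule.mem_sup_left hy))
      (fun l => (Submodule.Quotient.mk_eq_zero W).mpr
        (hW ▸ Submodule.mem_sup_right (Submodule.subset_span ⟨l, rfl⟩)))
  -- Once `D(c)` is a unit, `N` is generated by `e` modulo the generators at `h + c`.
  have hgen (c : σ → R) (hc : IsUnit (MvPolynomial.eval c D)) :
      N ≤ (B ⊔ Submodule.span R (Set.range fun l => g l (h + c))) ⊔ Submodule.span R {e} := by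
    set W := B ⊔ Submodule.span R (Set.range fun l => g l (h + c)) with hW
    have hw (l) : w l ∈ W ⊔ Submodule.span R {e} := by
      rw [← Submodule.smul_mem_iff_of_isUnit _ hc]
      have h1 := (hmkQ c hW).1 l
      rw [eq_neg_iff_add_eq_zero, ← W.mkQ.map_smul, ← W.mkQ.map_smul, ← map_add,
        Submodule.mkQ_apply, Submodule.Quotient.mk_eq_zero] at h1
      rw [← add_sub_cancel_right (MvPolynomial.eval c D • w l)]
      exact Submodule.sub_mem _ (Submodule.mem_sup_left h1) (Submodule.mem_sup_right
        (Submodule.smul_mem _ _ (Submodule.mem_span_singleton_self e)))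
    refine hN.trans (sup_le (sup_le (le_sup_of_le_left le_sup_left) ?_) le_sup_right)
    rw [Submodule.span_le]
    rintro _ ⟨l, rfl⟩
    exact hw l
  by_cases hcase : ∃ q, MvPolynomial.map (residue R) (P q) ≠ 0
  · -- For general `c`, the relation `P q (c)` is a unit and `e` vanishes in the quotient.
    obtain ⟨q, hq⟩ := hcase
    refine ⟨D * P q, by rw [map_mul]; exact mul_ne_zero hDne hq, fun c hc => ?_⟩
    rw [map_mul] at hc
    obtain ⟨hc1, hc2⟩ := IsUnit.mul_iff.mp hc
    refine ⟨e, heN, hgen c hc1, fun a _ => Submodule.smul_mem _ _ ?_⟩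
    have h1 := (hmkQ c rfl).2 q
    have hu : IsUnit (MvPolynomial.eval c D * μ q + MvPolynomial.eval c (P q)) := by
      rw [← residue_ne_zero_iff_isUnit, map_add, map_mul, (residue_eq_zero_iff (μ q)).mpr (hμm q),
        mul_zero, zero_add, residue_ne_zero_iff_isUnit]
      exact hc2
    rw [← map_smul, Submodule.mkQ_apply, Submodule.Quotient.mk_eq_zero] at h1
    exact (Submodule.smul_mem_iff_of_isUnit _ hu).mp h1
  · -- Otherwise `P q = ∑ ρ q q' * μ q'` with `ρ` vanishing at `0`, and `T = D + ρ` is a matrix with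
    -- `T(0) = 1` and `T(c)` mapping the vector of all `μ q • e` to zero.
    push Not at hcase
    have hρ (q) : ∃ ρ : Fin p → MvPolynomial σ R, (∀ q', MvPolynomial.constantCoeff (ρ q') = 0) ∧
        ∑ q', ρ q' * MvPolynomial.C (μ q') = P q := by
      have h1 : P q ∈ Ideal.map MvPolynomial.C (maximalIdeal R) := by
        rw [MvPolynomial.mem_map_C_iff]
        intro m
        rw [← residue_eq_zero_iff, ← MvPolynomial.coeff_map, hcase q, MvPolynomial.coeff_zero]
      rw [← hμ] at h1
      change P q ∈ Ideal.map MvPolynomial.C (Ideal.span _) at h1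
      rw [Ideal.map_span, ← Set.range_comp] at h1
      obtain ⟨ρ, hρ⟩ := Ideal.mem_span_range_iff_exists_fun.mp h1
      refine ⟨fun q' => ρ q' - MvPolynomial.C (MvPolynomial.constantCoeff (ρ q')),
        fun q' => by simp, ?_⟩
      have h2 := congrArg (fun f => MvPolynomial.C (σ := σ) (MvPolynomial.constantCoeff f)) hρ
      simp only [map_sum, map_mul, Function.comp_apply, MvPolynomial.constantCoeff_C, hP0,
        map_zero] at h2
      simp only [sub_mul, Finset.sum_sub_distrib]
      rw [h2, sub_zero]
      exact hρ
    choose ρ hρ0 hρ using hρ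
    let T : Matrix (Fin p) (Fin p) (MvPolynomial σ R) := D • 1 + Matrix.of ρ
    have hT0 : MvPolynomial.constantCoeff T.det = 1 := by
      have : MvPolynomial.constantCoeff.mapMatrix T = 1 := by
        ext q q'
        simp only [RingHom.mapMatrix_apply, Matrix.map_apply, T, Matrix.add_apply,
          Matrix.smul_apply, Matrix.of_apply, map_add, hρ0, add_zero, smul_eq_mul, map_mul, hD0,
          one_mul, Matrix.one_apply]
        split_ifs <;> simp
      rw [RingHom.map_det, this, Matrix.det_one]
    refine ⟨D * T.det, ?_, fun c hc => ?_⟩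
    · intro h0
      have := congrArg MvPolynomial.constantCoeff h0
      simp [MvPolynomial.constantCoeff_map, hD0, hT0] at this
    · rw [map_mul] at hc
      obtain ⟨hc1, hc2⟩ := IsUnit.mul_iff.mp hc
      refine ⟨e, heN, hgen c hc1, ?_⟩
      set W := B ⊔ Submodule.span R (Set.range fun l => g l (h + c)) with hW
      have h1 := (hmkQ c hW).2
      have h2 (q) : ∑ q', ((MvPolynomial.eval c).mapMatrix T) q q' • (μ q' • W.mkQ e) = 0 := by
        rw [← h1 q, ← hρ q]
        simp only [RingHom.mapMatrix_apply, Matrix.map_apply, T, Matrix.add_apply,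
          Matrix.smul_apply, Matrix.of_apply, map_add, smul_eq_mul, map_mul, add_mul, add_smul,
          Finset.sum_add_distrib, smul_smul, map_sum, MvPolynomial.eval_C, Finset.sum_smul]
        congr 1
        rw [Finset.sum_eq_single q]
        · rw [Matrix.one_apply_eq, map_one, mul_one]
        · intro q' _ hq'
          simp [Matrix.one_apply_ne hq'.symm]
        · simp
      have h3 (q) : μ q • W.mkQ e = 0 := by
        have := det_smul_eq_of_sum_smul_eq _ (fun q => μ q • W.mkQ e) (fun _ => 0) h2 q
        rw [← RingHom.map_det] at this
        simp only [smul_zero, Finset.sum_const_zero] at this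
        exact (hc2.smul_eq_zero).mp this
      have h4 : maximalIdeal R ≤ Submodule.comap (LinearMap.toSpanSingleton R M e) W := by
        rw [← hμ, Submodule.span_le]
        rintro _ ⟨q, rfl⟩
        have := h3 q
        rw [← map_smul, Submodule.mkQ_apply, Submodule.Quotient.mk_eq_zero] at this
        exact this
      exact fun a ha => h4 ha

end

/-! ### Stretched ideals and general elements -/

lemma le_saturation {R : Type*} [CommRing R] (J I : Ideal R) : J ≤ saturation J I :=
  fun _ hb => ⟨1, one_pos, fun c _ => J.mul_mem_right c hb⟩

section
variable {R : Type*} [CommRing R] [IsLocalRing R]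

/-- Lengths at most one over a quotient `S` of a local ring `R`, where `S` may be zero: `A / B` is
cyclic and killed by the maximal ideal of `R`. -/
lemma quotLength_le_one_iff {S : Type*} [CommRing S] {q : R →+* S} (hq : Function.Surjective q)
    (A B : Ideal S) :
    quotLength A B ≤ 1 ↔
      ∃ e ∈ A, A ≤ B ⊔ Ideal.span {e} ∧ ∀ μ ∈ maximalIdeal R, q μ * e ∈ B := by
  rw [quotLength]
  constructor
  · intro h
    rcases Order.le_one_iff.mp h with h | h
    · rw [Module.length_eq_zero_iff, Submodule.Quotient.subsingleton_iff,
        Submodule.submoduleOf_eq_top] at h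
      exact ⟨0, A.zero_mem, le_sup_of_le_left h, by simp⟩
    · obtain ⟨n, hn, ⟨φ⟩⟩ := isSimpleModule_iff_quot_maximal.mp (Module.length_eq_one_iff.mp h)
      obtain ⟨e, he⟩ := Submodule.Quotient.mk_surjective _ (φ.symm (Ideal.Quotient.mk n 1))
      have key (s : S) : φ (Submodule.Quotient.mk (s • e)) = Ideal.Quotient.mk n s := by
        rw [Submodule.Quotient.mk_smul, he, map_smul, φ.apply_symm_apply]
        change Ideal.Quotient.mk n (s * 1) = _
        rw [mul_one]
      refine ⟨e, e.2, fun y hy => ?_, fun μ hμ => ?_⟩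
      · obtain ⟨s, hs⟩ := Ideal.Quotient.mk_surjective (φ (Submodule.Quotient.mk ⟨y, hy⟩))
        rw [← key, φ.injective.eq_iff, eq_comm, Submodule.Quotient.eq] at hs
        have hs : y - s * e ∈ B := hs
        rw [← sub_add_cancel y (s * e)]
        exact Submodule.add_mem_sup hs (Ideal.mem_span_singleton'.mpr ⟨s, rfl⟩)
      · have hc : n.comap q = maximalIdeal R :=
          eq_maximalIdeal (Ideal.comap_isMaximal_of_surjective q hq)
        have h0 : φ (Submodule.Quotient.mk (q μ • e)) = 0 := by
          rw [key, Ideal.Quotient.eq_zero_iff_mem, ← Ideal.mem_comap, hc]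
          exact hμ
        rw [map_eq_zero_iff _ φ.injective, Submodule.Quotient.mk_eq_zero] at h0
        exact h0
  · rintro ⟨e, he, hA, hm⟩
    set n : Ideal S := (maximalIdeal R).map q
    have hn : Module.length S (S ⧸ n) ≤ 1 := by
      rcases Ideal.map_eq_top_or_isMaximal_of_surjective q hq
        (inferInstance : (maximalIdeal R).IsMaximal) with h | h
      · have : Subsingleton (S ⧸ n) := (Submodule.Quotient.subsingleton_iff).mpr h
        simp [Module.length_eq_zero]
      · have : IsSimpleModule S (S ⧸ n) :=
          isSimpleModule_iff_quot_maximal.mpr ⟨n, h, ⟨LinearEquiv.refl _ _⟩⟩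
        exact (Module.length_eq_one S _).le
    refine le_trans ?_ hn
    let f : S →ₗ[S] (A ⧸ B.submoduleOf A) :=
      LinearMap.toSpanSingleton S _ (Submodule.Quotient.mk ⟨e, he⟩)
    have hf : n ≤ LinearMap.ker f := by
      rw [Ideal.map_le_iff_le_comap]
      intro μ hμ
      change f (q μ) = 0
      simp only [f, LinearMap.toSpanSingleton_apply, ← Submodule.Quotient.mk_smul,
        Submodule.Quotient.mk_eq_zero]
      exact hm μ hμ
    refine Module.length_le_of_surjective (Submodule.liftQ n f hf) fun y => ?_
    obtain ⟨⟨y, hy⟩, rfl⟩ := Submodule.Quotient.mk_surjective _ y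
    obtain ⟨b, hb, z, hz, rfl⟩ := Submodule.mem_sup.mp (hA hy)
    obtain ⟨s, rfl⟩ := Ideal.mem_span_singleton'.mp hz
    refine ⟨Submodule.Quotient.mk s, ?_⟩
    rw [Submodule.liftQ_apply]
    simp only [f, LinearMap.toSpanSingleton_apply, ← Submodule.Quotient.mk_smul]
    rw [eq_comm, Submodule.Quotient.eq]
    change b + s * e - s * e ∈ B
    simpa using hb

/-- For a minimal reduction `H` as in the definition of a stretched ideal,
`I ^ 2 / (H I + I ^ 3)` is `I ^ 2 / (H ⊓ I ^ 2 + I ^ 3)`, the second graded piece of `I / H`. -/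
lemma isCyclicMod_of_hilbertFunction_le_one {H I : Ideal R} (hH : H ⊓ I ^ 2 = H * I)
    (h : hilbertFunction (I.map (Ideal.Quotient.mk H)) 2 ≤ 1) :
    IsCyclicMod (I ^ 2) (I ^ 3 ⊔ H * I) := by
  obtain ⟨e', he', hA, hm⟩ := (quotLength_le_one_iff Ideal.Quotient.mk_surjective _ _).mp h
  rw [← Ideal.map_pow] at he'
  obtain ⟨e, he, rfl⟩ := (Ideal.mem_map_iff_of_surjective _ Ideal.Quotient.mk_surjective).mp he'
  -- By the modular law, `H ⊓ I ^ 2 = H I` turns membership modulo `H` into membership modulo `H I`.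
  have key {y : R} (hy : y ∈ I ^ 2)
      (hq : Ideal.Quotient.mk H y ∈ (I.map (Ideal.Quotient.mk H)) ^ (2 + 1)) :
      y ∈ I ^ 3 ⊔ H * I := by
    rw [← Ideal.map_pow, Ideal.mem_quotient_iff_mem_sup] at hq
    obtain ⟨z, hz, t, ht, rfl⟩ := Submodule.mem_sup.mp hq
    refine Submodule.add_mem_sup hz (hH ▸ ⟨ht, ?_⟩)
    have := (I ^ 2).sub_mem hy (Ideal.pow_le_pow_right (show 2 ≤ 2 + 1 by norm_num) hz)
    simpa using this
  refine ⟨e, he, fun y hy => ?_, fun μ hμ => ?_⟩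
  · have hy' : Ideal.Quotient.mk H y ∈ (I.map (Ideal.Quotient.mk H)) ^ 2 := by
      rw [← Ideal.map_pow]; exact Ideal.mem_map_of_mem _ hy
    obtain ⟨b, hb, z, hz, hbz⟩ := Submodule.mem_sup.mp (hA hy')
    obtain ⟨s, rfl⟩ := Ideal.mem_span_singleton'.mp hz
    obtain ⟨s, rfl⟩ := Ideal.Quotient.mk_surjective s
    rw [← map_mul] at hbz
    rw [← eq_sub_iff_add_eq, ← map_sub] at hbz
    rw [← sub_add_cancel y (s * e)]
    exact Submodule.add_mem_sup (key (Ideal.sub_mem _ hy (Ideal.mul_mem_left _ _ he)) (hbz ▸ hb))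
      (Ideal.mem_span_singleton'.mpr ⟨s, rfl⟩)
  · exact key (Ideal.mul_mem_left _ _ he) (by simpa using hm μ hμ)

/-- The ring `R / (J_{d-1} : I^∞)` is a quotient of `R / J_{d-1}`, hence the length defining
`j`-stretchedness is at most `λ(I ^ 2 / (I ^ 3 + J I))`, where `J` is generated by `x`. -/
lemma stretchLength_le_one {I : Ideal R} {d : ℕ} {x : Fin d → R}
    (h : IsCyclicMod (I ^ 2) (I ^ 3 ⊔ Ideal.span (Set.range x) * I)) :
    stretchLength I x ≤ 1 := by
  obtain ⟨e, he, hA, hm⟩ := h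
  set K := saturation (initIdeal x) I
  let q := Ideal.Quotient.mk K
  have hJ : (Ideal.span (Set.range x)).map q ≤ (lastIdeal x).map q := by
    rw [Ideal.map_le_iff_le_comap, Ideal.span_le]
    rintro _ ⟨i, rfl⟩
    change q (x i) ∈ (lastIdeal x).map q
    by_cases hi : (i : ℕ) + 1 < d
    · have h1 : x i ∈ K := le_saturation _ _ (Ideal.subset_span ⟨i, hi, rfl⟩)
      rw [Ideal.Quotient.eq_zero_iff_mem.mpr h1]
      exact Ideal.zero_mem _
    · exact Ideal.mem_map_of_mem _ (Ideal.subset_span ⟨i, show (i : ℕ) + 1 = d by omega, rfl⟩)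
  have hB : (I ^ 3 ⊔ Ideal.span (Set.range x) * I).map q ≤
      (lastIdeal x).map q * I.map q ⊔ (I.map q) ^ 3 := by
    rw [Ideal.map_sup, Ideal.map_pow, Ideal.map_mul]
    exact sup_le le_sup_right (le_sup_of_le_left (Ideal.mul_mono_left hJ))
  refine (quotLength_le_one_iff (q := q) Ideal.Quotient.mk_surjective _ _).mpr ⟨q e, ?_, ?_, ?_⟩
  · rw [← Ideal.map_pow]; exact Ideal.mem_map_of_mem _ he
  · rw [← Ideal.map_pow]
    refine (Ideal.map_mono hA).trans ?_
    have := Ideal.map_span q {e}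
    rw [Set.image_singleton] at this
    rw [← this]
    rw [Ideal.map_sup]
    exact sup_le_sup_right hB _
  · intro μ hμ
    rw [← map_mul]
    exact hB (Ideal.mem_map_of_mem _ (hm μ hμ))

lemma isZariskiDenseOpen_eval_ne_zero {k σ : Type*} [Field k] [Infinite k]
    {F : MvPolynomial σ k} (hF : F ≠ 0) :
    IsZariskiDenseOpen {v : σ → k | MvPolynomial.eval v F ≠ 0} := by
  refine ⟨⟨{F}, by simp⟩, ?_⟩
  rintro _ ⟨T, rfl⟩ ⟨v, f, hf, hv⟩
  have hf0 : f ≠ 0 := by rintro rfl; simp at hv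
  obtain ⟨w, hw⟩ : ∃ w, MvPolynomial.eval w (F * f) ≠ 0 := by
    by_contra! h
    exact mul_ne_zero hF hf0 (MvPolynomial.funext fun v => by simpa using h v)
  rw [map_mul] at hw
  exact ⟨w, left_ne_zero_of_mul hw, f, hf, right_ne_zero_of_mul hw⟩

/-- If `I ^ 2 / (H I + I ^ 3)` has length at most one for some ideal `H ≤ I` with `d` generators,
then the same holds for the ideal generated by `d` general elements of `I`. -/
lemma forGeneralElements_isCyclicMod [IsNoetherianRing R] (hk : Infinite (ResidueField R))
    {I : Ideal R} {d : ℕ} (y : Fin d → R) (hy : ∀ i, y i ∈ I)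
    (h : IsCyclicMod (I ^ 2) (I ^ 3 ⊔ Ideal.span (Set.range y) * I)) :
    ForGeneralElements I d
      (fun x => IsCyclicMod (I ^ 2) (I ^ 3 ⊔ Ideal.span (Set.range x) * I)) := by
  intro s a ha
  have haI (j) : a j ∈ I := ha ▸ Ideal.subset_span ⟨j, rfl⟩
  let g : Fin d × Fin s → (Fin d × Fin s → R) →ₗ[R] R := fun l =>
    ∑ j, (a j * a l.2) • LinearMap.proj (l.1, j)
  have hg (l c) : g l c = (∑ j, c (l.1, j) * a j) * a l.2 := by
    simp only [g, LinearMap.sum_apply, LinearMap.smul_apply, LinearMap.proj_apply, smul_eq_mul,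
      Finset.sum_mul]
    exact Finset.sum_congr rfl fun j _ => by ring
  have hspan (c : Fin d × Fin s → R) : Ideal.span (Set.range fun i => ∑ j, c (i, j) * a j) * I =
      Submodule.span R (Set.range fun l => g l c) := by
    conv_lhs => rw [← ha, Ideal.span_mul_span']
    refine congrArg Ideal.span (Set.ext fun z => ?_)
    simp only [Set.mem_mul, Set.mem_range, hg, Prod.exists]
    aesop
  choose c₀ hc₀ using fun i => Ideal.mem_span_range_iff_exists_fun.mp (ha.symm ▸ hy i)
  have hy' : y = fun i => ∑ j, Function.uncurry c₀ (i, j) * a j :=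
    funext fun i => (hc₀ i).symm
  rw [hy', hspan] at h
  have hgI (l c) : g l c ∈ I ^ 2 := by
    rw [hg, pow_two]
    exact Ideal.mul_mem_mul (Ideal.sum_mem _ fun j _ => Ideal.mul_mem_left _ _ (haI j)) (haI _)
  obtain ⟨F, hF, hFc⟩ := exists_polynomial_isCyclicMod hk (I ^ 2) (I ^ 3) g hgI _ h
  refine ⟨_, isZariskiDenseOpen_eval_ne_zero hF, fun c hc => ?_⟩
  beta_reduce
  rw [hspan]
  exact hFc c hc

end
end JStretched

theorem mainTheorem9 {R : Type*} [CommRing R] [IsLocalRing R] [IsNoetherianRing R]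
    (hCM : JStretched.IsCohenMacaulayLocalRing R)
    (hchar : JStretched.IsEquicharacteristic R)
    (hk : Infinite (IsLocalRing.ResidueField R))
    (I : Ideal R) (hI : I.radical = IsLocalRing.maximalIdeal R)
    (hstr : JStretched.IsStretched I) :
    JStretched.IsJStretched I := by
  obtain ⟨H, hH, hHI, hHF⟩ := hstr
  obtain ⟨d, hd⟩ : ∃ d : ℕ, ringKrullDim R = d := by
    rw [← IsLocalRing.maximalIdeal_height_eq_ringKrullDim]
    obtain ⟨d, hd⟩ := ENat.ne_top_iff_exists.mp
      (Ideal.height_ne_top (I := IsLocalRing.maximalIdeal R) (Ideal.IsPrime.ne_top inferInstance))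
    exact ⟨d, by rw [← hd]; rfl⟩
  obtain ⟨y, hy⟩ := JStretched.exists_span_range_eq_of_spanFinrank H (hH.spanFinrank_eq hk hI hd)
  refine ⟨d, hd, JStretched.analyticSpread_eq hk hI hH hd, fun s a ha => ?_⟩
  have hyI (i) : y i ∈ I := hH.prop.1 (hy ▸ Ideal.subset_span ⟨i, rfl⟩)
  obtain ⟨U, hU, hUc⟩ := JStretched.forGeneralElements_isCyclicMod hk y hyI
    (hy.symm ▸ JStretched.isCyclicMod_of_hilbertFunction_le_one hHI hHF) s a ha
  exact ⟨U, hU, fun c hc => JStretched.stretchLength_le_one (hUc c hc)⟩
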